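/- Let $\mathbb K$ be $\mathbb R$ or $\mathbb C$; all vector spaces are over $\mathbb K$. **Notation.** For a topological vector space $Y$, $Y'$ is its topological dual, and its strong dual is $Y'$ with the topology $\beta(Y',Y)$ of uniform convergence on the bounded subsets of $Y$; $\sigma(Y',Y)$ is the topology of pointwise convergence on $Y$. A Hausdorff locally convex space $Y$ is *quasi-$\ell_\infty$-barrelled* if every bounded sequence in its strong dual is equicontinuous. A *Fréchet space* is a locally convex, completely metrizable topological vector space; a Fréchet space $X$ is *reflexive* if the canonical map $X\to X''$, $x\mapsto(u\mapsto\langle u,x\rangle)$, is an isomorphism of topological vector spaces onto the strong dual of the strong dual of $X$. Let $T:X\to X$ be a continuous linear operator on a Fréchet space. For $x\in X$ put $\mathcal O_T(x)=\{T^nx : n\ge 1\}$ and, for $U\subset X$, $\mathcal N_T(x,U)=\{n\ge 1 : T^nx\in U\}$. * $x$ is *reiteratively recurrent* ($x\in\operatorname{RRec}(T)$) if for every neighbourhood $U$ of $x$ the set $A=\mathcal N_T(x,U)$ has positive upper Banach density $$\overline{\operatorname{Bd}}(A)=\limsup_{N\to\infty}\ \max_{m\ge 0}\frac{\#(A\cap[m+1,m+N])}{N}>0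 .$$ * $x$ has a *locally bounded orbit* ($x\in\ell bo(T)$) if there is a neighbourhood $U$ of $x$ such that $U\cap\mathcal O_T(x)$ is bounded in $X$. Measures are Borel measures on $X$; $\mu$ is *$T$-invariant* if $\mu(T^{-1}(A))=\mu(A)$ for all Borel sets $A$, *non-trivial* if $\mu\ne\delta_0$, and has *full support* if $\mu(U)>0$ for every non-empty open set $U$. The support $\operatorname{supp}(\mu)$ is the set of points all of whose neighbourhoods have positive measure. **Theorem.** (1) Let $Y$ be a quasi-$\ell_\infty$-barrelled Hausdorff locally convex space whose strong dual $X=(Y',\beta(Y',Y))$ is a separable Fréchet space, and let $T:X\to X$ be a continuous linear operator that is the adjoint of some linear map $S:Y\to Y$, that is, $\langle Su,x\rangle=\langle u,Tx\rangle$ for all $u\in Y$, $x\in X$. (a) For every $x_0\in\operatorname{RRec}(T)\cap\ell bo(T)$ there is a $T$-invariant probability measure $\mu_{x_0}$ on $X$ with $$x_0\in\operatorname{supp}(\mu_{x_0})\subset\overline{\mathcal O_T(x_0)}^{\,\sigma(X,Y)},$$ and $\mu_{x_0}$ is non-trivial if $x_0\neq 0$. (b) If $\operatorname{RRec}(T)\cap\ell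 bo(T)$ is dense in $X$, then there is a $T$-invariant probability measure on $X$ with full support. (2) Let $X$ be a separable reflexive Fréchet space and $T:X\to X$ any continuous linear operator. Then (a) and (b) hold for $T$, with the weak topology $\sigma(X,X')$ in place of $\sigma(X,Y)$. -/

import Mathlib

open Filter MeasureTheory Topology

namespace LinDyn

/-- The orbit `{T x, T² x, T³ x, …}` of `x` under `T`. -/
def orbit {X : Type*} (T : X → X) (x : X) : Set X :=
  {z | ∃ n : ℕ, 1 ≤ n ∧ T^[n] x = z}

/-- The set of return times `n ≥ 1` with `Tⁿ x ∈ E`. -/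
def returnSet {X : Type*} (T : X → X) (x : X) (E : Set X) : Set ℕ :=
  {n | 1 ≤ n ∧ T^[n] x ∈ E}

/-- The upper Banach density `limsup_{N → ∞} max_{m ≥ 0} #(A ∩ [m + 1, m + N]) / N`. All the
quotients lie in `[0, 1]`, so the real supremum and upper limit are the genuine ones. -/
noncomputable def upperBanachDensity (A : Set ℕ) : ℝ :=
  limsup (fun N : ℕ => ⨆ m : ℕ, ((A ∩ Set.Icc (m + 1) (m + N)).ncard : ℝ) / (N : ℝ)) atTop

/-- `x` is reiteratively recurrent for `T`: its return set to each of its neighbourhoods has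
positive upper Banach density. -/
def IsReiterativelyRecurrent {X : Type*} [TopologicalSpace X] (T : X → X) (x : X) : Prop :=
  ∀ U ∈ 𝓝 x, 0 < upperBanachDensity (returnSet T x U)

/-- `x` has a locally bounded orbit for `T`: some neighbourhood of `x` meets the orbit of `x` in a
bounded set. -/
def HasLocallyBoundedOrbit (𝕜 : Type*) {X : Type*} [RCLike 𝕜] [AddCommGroup X] [Module 𝕜 X]
    [TopologicalSpace X] (T : X → X) (x : X) : Prop :=
  ∃ U ∈ 𝓝 x, Bornology.IsVonNBounded 𝕜 (U ∩ orbit T x)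

/-- `Y` is quasi-`ℓ∞`-barrelled: every bounded sequence in the strong dual of `Y` is
equicontinuous. (`StrongDual 𝕜 Y` carries the topology of uniform convergence on the bounded
subsets of `Y`.) -/
def IsQuasiLInftyBarrelled (𝕜 Y : Type*) [RCLike 𝕜] [AddCommGroup Y] [Module 𝕜 Y]
    [TopologicalSpace Y] : Prop :=
  ∀ f : ℕ → StrongDual 𝕜 Y, Bornology.IsVonNBounded 𝕜 (Set.range f) →
    Equicontinuous (fun n y => f n y)

/-- The canonical map of `X` into its strong bidual, `x ↦ (u ↦ u x)`. -/
noncomputable def evalBidual (𝕜 : Type*) {X : Type*} [RCLike 𝕜] [AddCommGroup X] [Module 𝕜 X]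
    [TopologicalSpace X] [ContinuousSMul 𝕜 X] (x : X) : StrongDual 𝕜 (StrongDual 𝕜 X) :=
  { toFun := fun u => u x
    map_add' := fun _ _ => rfl
    map_smul' := fun _ _ => rfl
    cont := continuous_eval_const x }

/-- `X` is reflexive: the canonical linear map of `X` into its strong bidual is an isomorphism of
topological vector spaces. -/
def IsReflexiveSpace (𝕜 X : Type*) [RCLike 𝕜] [AddCommGroup X] [Module 𝕜 X]
    [TopologicalSpace X] [ContinuousSMul 𝕜 X] : Prop :=
  IsHomeomorph (evalBidual 𝕜 : X → StrongDual 𝕜 (StrongDual 𝕜 X))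

/-- The closure of `A ⊆ Y'` for the weak topology `σ(Y', Y)`. -/
def weakStarClosure {𝕜 Y : Type*} [RCLike 𝕜] [AddCommGroup Y] [Module 𝕜 Y] [TopologicalSpace Y]
    (A : Set (StrongDual 𝕜 Y)) : Set (StrongDual 𝕜 Y) :=
  StrongDual.toWeakDual ⁻¹' closure (StrongDual.toWeakDual '' A)

/-- The closure of `A ⊆ X` for the weak topology `σ(X, X')`. -/
def weakClosure (𝕜 : Type*) {X : Type*} [RCLike 𝕜] [AddCommGroup X] [Module 𝕜 X]
    [TopologicalSpace X] (A : Set X) : Set X :=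
  toWeakSpace 𝕜 X ⁻¹' closure (toWeakSpace 𝕜 X '' A)

end LinDyn

namespace LinDyn

/-! The local boundedness of the orbit replaces the compactness that Krylov–Bogoliubov needs. Near
`x₀` the orbit is bounded, hence equicontinuous: by the barrelledness hypothesis in (1), since an
orbit is countable, and in (2) because bounded subsets of `X` are equicontinuous on the strong dual.
The strong topology has weak-* closed neighbourhoods, so by Alaoglu each neighbourhood `V` of `x₀`
contains a weak-* compact set `K` visited with positive upper Banach density.

The adjoint `T` is modelled by a shift: `z ↦ (z (Sⁿ d))`, with `d` in a countable separating set and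
the scalars squeezed into a ball, embeds the dual continuously in a compact metrizable space. An
invariant measure charging the image of `K` exists there. It may have mass off the image of the
dual, so it is restricted to the forward orbit of `K`, which is σ-compact and lies in that image,
and then pulled back (`exists_invariant_measure_of_semiconj`).

A convex combination over a countable base of neighbourhoods puts `x₀` in the support
(`exists_invariant_measure_mem_support`); one over a countable dense set of points gives full
support. -/

/-! ### Krylov–Bogoliubov along long orbit windows. -/

/-- The uniform probability measure on the orbit segment `τ^(m+1) q, …, τ^(m+N) q`. -/
noncomputable def empiricalMeasure {Q : Type*} [MeasurableSpace Q] (τ : Q → Q) (q : Q)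
    (m N : ℕ) : Measure Q :=
  (N : ENNReal)⁻¹ • ∑ i ∈ Finset.range N, Measure.dirac (τ^[m + 1 + i] q)

theorem isProbabilityMeasure_empiricalMeasure {Q : Type*} [MeasurableSpace Q] (τ : Q → Q) (q : Q)
    (m : ℕ) {N : ℕ} (hN : N ≠ 0) : IsProbabilityMeasure (empiricalMeasure τ q m N) := by
  constructor
  simp [empiricalMeasure, Measure.finsetSum_apply]
  exact ENNReal.inv_mul_cancel (by simpa using hN) (by simp)

theorem integral_empiricalMeasure {Q : Type*} [MeasurableSpace Q] [TopologicalSpace Q]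
    [OpensMeasurableSpace Q] (τ : Q → Q) (q : Q) (m N : ℕ) (f : BoundedContinuousFunction Q ℝ) :
    ∫ z, f z ∂(empiricalMeasure τ q m N) =
      (N : ℝ)⁻¹ * ∑ i ∈ Finset.range N, f (τ^[m + 1 + i] q) := by
  rw [empiricalMeasure, integral_smul_measure, integral_finsetSum_measure]
  · simp [integral_dirac' _ _ f.continuous.measurable.stronglyMeasurable]
  · intro i _
    exact f.integrable _

theorem empiricalMeasure_apply {Q : Type*} [MeasurableSpace Q] (τ : Q → Q) (q : Q) (m N : ℕ)
    {C : Set Q} (hC : MeasurableSet C) :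
    empiricalMeasure τ q m N C =
      (N : ENNReal)⁻¹ * ((returnSet τ q C ∩ Set.Icc (m + 1) (m + N)).ncard : ENNReal) := by
  classical
  have h : returnSet τ q C ∩ Set.Icc (m + 1) (m + N) =
      ((Finset.range N).filter (fun i => τ^[m + 1 + i] q ∈ C)).image (fun i => m + 1 + i) := by
    ext n
    simp only [returnSet, Set.mem_inter_iff, Set.mem_ofPred_eq, Set.mem_Icc, Finset.coe_image,
      Finset.coe_filter, Finset.mem_range, Set.mem_image]
    constructor
    · rintro ⟨⟨_, h1⟩, h2, h3⟩
      exact ⟨n - (m + 1), ⟨by omega, by rwa [Nat.add_sub_cancel' h2]⟩, by omega⟩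
    · rintro ⟨i, ⟨h1, h2⟩, rfl⟩
      exact ⟨⟨by omega, h2⟩, by omega, by omega⟩
  rw [h, Set.ncard_coe_finset, Finset.card_image_of_injective _ (add_right_injective (m + 1)),
    empiricalMeasure, Measure.smul_apply, Measure.finsetSum_apply, Finset.card_filter]
  simp [Measure.dirac_apply' _ hC, Set.indicator_apply]

theorem frequently_lt_of_upperBanachDensity_pos {A : Set ℕ} (hA : 0 < upperBanachDensity A) :
    ∃ c : ℝ, 0 < c ∧ ∀ k : ℕ, ∃ N, k < N ∧ ∃ m : ℕ,
      c < ((A ∩ Set.Icc (m + 1) (m + N)).ncard : ℝ) / (N : ℝ) := by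
  obtain ⟨c, hc0, hc⟩ := exists_between hA
  refine ⟨c, hc0, fun k => ?_⟩
  have hf := frequently_lt_of_lt_limsup (by
    refine ⟨0, ?_⟩
    intro b hb
    obtain ⟨N, hN⟩ := (eventually_map.1 hb).exists
    exact (Real.iSup_nonneg fun m => by positivity).trans hN) hc
  obtain ⟨N, hN, hlt⟩ := frequently_atTop'.1 hf k
  exact ⟨N, hN, exists_lt_of_lt_ciSup hlt⟩

/-- Krylov–Bogoliubov: an orbit visiting a closed set with positive upper Banach density yields
an invariant probability measure charging that set. -/
theorem exists_invariant_measure_of_upperBanachDensity_pos {Q : Type*} [TopologicalSpace Q]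
    [CompactSpace Q] [TopologicalSpace.MetrizableSpace Q] [MeasurableSpace Q] [BorelSpace Q]
    {τ : Q → Q} (hτ : Continuous τ) (q : Q) {C : Set Q} (hC : IsClosed C)
    (hd : 0 < upperBanachDensity (returnSet τ q C)) :
    ∃ μ : Measure Q, IsProbabilityMeasure μ ∧ MeasurePreserving τ μ μ ∧ 0 < μ C := by
  let _ := TopologicalSpace.metrizableSpaceMetric Q
  obtain ⟨c, hc0, hc⟩ := frequently_lt_of_upperBanachDensity_pos hd
  choose N hN m hm using hc
  let P : ℕ → ProbabilityMeasure Q := fun k => ⟨empiricalMeasure τ q (m k) (N k),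
    isProbabilityMeasure_empiricalMeasure τ q (m k) (by have := hN k; omega)⟩
  -- Probability measures on a compact metrizable space form a compact space; a free ultrafilter
  -- picks a limit without extracting subsequences.
  obtain ⟨ν, -, hν⟩ := isCompact_univ.ultrafilter_le_nhds ((hyperfilter ℕ).map P) (by simp)
  have hlim : Tendsto P (hyperfilter ℕ : Filter ℕ) (𝓝 ν) := hν
  have hmap : Tendsto (fun k => (P k).map hτ.measurable.aemeasurable) (hyperfilter ℕ : Filter ℕ)
      (𝓝 (ν.map hτ.measurable.aemeasurable)) :=
    ProbabilityMeasure.tendsto_map_of_tendsto_of_continuous _ _ hlim hτ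
  have hNtop : Tendsto N (hyperfilter ℕ : Filter ℕ) atTop :=
    (tendsto_atTop_mono (fun k => (hN k).le) tendsto_id).mono_left Nat.hyperfilter_le_atTop
  refine ⟨ν, inferInstance, ⟨hτ.measurable, ?_⟩, ?_⟩
  · have : IsProbabilityMeasure ((ν : Measure Q).map τ) :=
      Measure.isProbabilityMeasure_map hτ.measurable.aemeasurable
    refine ext_of_forall_integral_eq_of_IsFiniteMeasure fun f => ?_
    have h1 := (ProbabilityMeasure.tendsto_iff_forall_integral_tendsto.1 hlim) f
    have h2 := (ProbabilityMeasure.tendsto_iff_forall_integral_tendsto.1 hmap) f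
    -- The two averages differ by a telescoping sum, so by at most `2‖f‖ / N k`.
    have h3 : Tendsto (fun k => ∫ z, f z ∂((P k).map hτ.measurable.aemeasurable : Measure Q) -
        ∫ z, f z ∂(P k : Measure Q)) (hyperfilter ℕ : Filter ℕ) (𝓝 0) := by
      have h4 : Tendsto (fun k => ((N k : ℕ) : ℝ)⁻¹ * (2 * ‖f‖)) (hyperfilter ℕ : Filter ℕ)
          (𝓝 0) := by
        simpa using ((tendsto_natCast_atTop_atTop (R := ℝ)).comp hNtop).inv_tendsto_atTop.mul_const
          (2 * ‖f‖)
      refine squeeze_zero_norm (fun k => ?_) h4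
      have e1 : ∫ z, f z ∂((P k).map hτ.measurable.aemeasurable : Measure Q) =
          ((N k : ℕ) : ℝ)⁻¹ * ∑ i ∈ Finset.range (N k), f (τ^[m k + 1 + (i + 1)] q) := by
        rw [ProbabilityMeasure.toMeasure_map, integral_map hτ.measurable.aemeasurable
          f.continuous.aestronglyMeasurable]
        have := integral_empiricalMeasure τ q (m k) (N k)
          (f.compContinuous ⟨τ, hτ⟩)
        simp only [BoundedContinuousFunction.compContinuous_apply, ContinuousMap.coe_mk] at this
        refine this.trans ?_
        simp only [← add_assoc, Function.iterate_succ_apply']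
      have e2 : ∫ z, f z ∂(P k : Measure Q) =
          ((N k : ℕ) : ℝ)⁻¹ * ∑ i ∈ Finset.range (N k), f (τ^[m k + 1 + i] q) :=
        integral_empiricalMeasure τ q (m k) (N k) f
      rw [e1, e2, ← mul_sub, ← Finset.sum_sub_distrib,
        Finset.sum_range_sub (fun i => f (τ^[m k + 1 + i] q)), norm_mul, norm_inv,
        Real.norm_natCast]
      gcongr
      refine (norm_sub_le _ _).trans ?_
      linarith [f.norm_coe_le_norm (τ^[m k + 1 + N k] q), f.norm_coe_le_norm (τ^[m k + 1 + 0] q)]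
    have h5 := tendsto_nhds_unique h3 (h2.sub h1)
    exact sub_eq_zero.1 h5.symm
  -- Portmanteau for closed sets: the lower bound `c` on the frequencies passes to the limit.
  · have h1 := ProbabilityMeasure.limsup_measure_closed_le_of_tendsto hlim hC
    refine lt_of_lt_of_le (ENNReal.ofReal_pos.2 hc0) (le_trans ?_ h1)
    refine le_limsup_of_frequently_le (Eventually.frequently (Eventually.of_forall fun k => ?_))
    have h2 := hm k
    have h3 : (P k : Measure Q) C = _ :=
      empiricalMeasure_apply τ q (m k) (N k) hC.measurableSet
    have hNk : (0 : ℝ) < N k := by exact_mod_cast (Nat.zero_le k).trans_lt (hN k)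
    rw [h3, mul_comm, ← div_eq_mul_inv]
    calc ENNReal.ofReal c ≤ ENNReal.ofReal (((returnSet τ q C ∩
          Set.Icc (m k + 1) (m k + N k)).ncard : ℝ) / (N k : ℝ)) := ENNReal.ofReal_le_ofReal h2.le
      _ = _ := by rw [ENNReal.ofReal_div_of_pos hNk]; simp

theorem upperBanachDensity_mono {A B : Set ℕ} (h : A ⊆ B) :
    upperBanachDensity A ≤ upperBanachDensity B := by
  have hle : ∀ (C : Set ℕ) (N m : ℕ),
      ((C ∩ Set.Icc (m + 1) (m + N)).ncard : ℝ) / (N : ℝ) ≤ 1 := by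
    intro C N m
    refine div_le_one_of_le₀ ?_ (by positivity)
    have h1 := Set.ncard_le_ncard (Set.inter_subset_right (s := C) (t := Set.Icc (m + 1) (m + N)))
      (Set.finite_Icc _ _)
    rw [← Finset.coe_Icc, Set.ncard_coe_finset, Nat.card_Icc] at h1
    simp only [Finset.coe_Icc] at h1
    exact_mod_cast h1.trans (by omega)
  have hbdd : ∀ (C : Set ℕ) (N : ℕ), BddAbove (Set.range fun m : ℕ =>
      ((C ∩ Set.Icc (m + 1) (m + N)).ncard : ℝ) / (N : ℝ)) := fun C N =>
    ⟨1, Set.forall_mem_range.2 (hle C N)⟩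
  refine limsup_le_limsup (Eventually.of_forall fun N => ?_) ?_ ?_
  · refine ciSup_mono (hbdd B N) fun m => ?_
    gcongr
    exact (Set.finite_Icc _ _).subset Set.inter_subset_right
  · exact isCoboundedUnder_le_of_le atTop (x := 0) fun N => Real.iSup_nonneg fun m => by positivity
  · exact isBoundedUnder_of ⟨1, fun N => ciSup_le (hle B N)⟩

/-! ### Combining, restricting and transporting invariant measures. -/

/-- A countable convex combination of invariant probability measures with the same null sets as
the whole sequence. -/
theorem exists_invariant_measure_apply_eq_zero_iff {X : Type*} [MeasurableSpace X] {T : X → X}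
    {μ : ℕ → Measure X} (hp : ∀ n, IsProbabilityMeasure (μ n))
    (hT : ∀ n, MeasurePreserving T (μ n) (μ n)) :
    ∃ ν : Measure X, IsProbabilityMeasure ν ∧ MeasurePreserving T ν ν ∧
      ∀ s, ν s = 0 ↔ ∀ n, μ n s = 0 := by
  refine ⟨Measure.sum fun n => ((2 : ENNReal)⁻¹ ^ (n + 1)) • μ n, ⟨?_⟩, ⟨(hT 0).measurable, ?_⟩,
    fun s => ?_⟩
  · simp [Measure.sum_apply _ MeasurableSet.univ, ENNReal.tsum_geometric_add_one]
    rw [ENNReal.inv_mul_cancel] <;> simp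
  · rw [Measure.map_sum (hT 0).measurable.aemeasurable]
    simp only [Measure.map_smul, (hT _).map_eq]
  · simp [Measure.sum_apply_eq_zero]

/-- An invariant measure can be normalized on a forward invariant set of positive measure. -/
theorem exists_invariant_measure_of_subset_preimage {Q : Type*} [MeasurableSpace Q] {τ : Q → Q}
    {ν : Measure Q} [IsProbabilityMeasure ν] (hν : MeasurePreserving τ ν ν) {E : Set Q}
    (hE : MeasurableSet E) (hτE : E ⊆ τ ⁻¹' E) (hpos : ν E ≠ 0) :
    ∃ ρ : Measure Q, IsProbabilityMeasure ρ ∧ MeasurePreserving τ ρ ρ ∧ ρ Eᶜ = 0 ∧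
      ∀ C, C ⊆ E → 0 < ν C → 0 < ρ C := by
  refine ⟨ProbabilityTheory.cond ν E, ProbabilityTheory.cond_isProbabilityMeasure hpos, ?_, ?_, ?_⟩
  -- `E` and its preimage are nested with equal finite measure, hence agree almost everywhere.
  · have h1 : ν.restrict (τ ⁻¹' E) = ν.restrict E := by
      refine Measure.restrict_congr_set (ae_eq_of_subset_of_measure_ge hτE ?_
        hE.nullMeasurableSet (measure_ne_top _ _)).symm
      exact (hν.measure_preimage hE.nullMeasurableSet).le
    have h2 := hν.restrict_preimage hE
    rw [h1] at h2
    exact h2.smul_measure _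
  · rw [ProbabilityTheory.cond_apply hE]
    simp
  · intro C hC hpos'
    rw [ProbabilityTheory.cond_apply hE, Set.inter_eq_self_of_subset_right hC]
    exact ENNReal.mul_pos (ENNReal.inv_ne_zero.2 (measure_ne_top _ _)) hpos'.ne'

/-- A preimage under `τ` may contain points outside the range of `Φ`, but these form a null set. -/
theorem measurePreserving_comap {X Q : Type*} [MeasurableSpace X] [MeasurableSpace Q] {T : X → X}
    {τ : Q → Q} {Φ : X → Q} (hΦ : MeasurableEmbedding Φ) (hT : Measurable T)
    (hsemi : ∀ x, Φ (T x) = τ (Φ x)) {ρ : Measure Q} (hρ : MeasurePreserving τ ρ ρ)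
    (hr : ρ (Set.range Φ)ᶜ = 0) : MeasurePreserving T (ρ.comap Φ) (ρ.comap Φ) := by
  refine ⟨hT, Measure.ext fun s hs => ?_⟩
  rw [Measure.map_apply hT hs, hΦ.comap_apply, hΦ.comap_apply,
    ← hρ.measure_preimage (hΦ.measurableSet_image.2 hs).nullMeasurableSet]
  have h : Φ '' (T ⁻¹' s) = τ ⁻¹' (Φ '' s) ∩ Set.range Φ := by
    ext q
    constructor
    · rintro ⟨x, hx, rfl⟩
      exact ⟨⟨T x, hx, hsemi x⟩, x, rfl⟩
    · rintro ⟨⟨y, hy, hxy⟩, x, rfl⟩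
      refine ⟨x, ?_, rfl⟩
      rw [← hsemi] at hxy
      have := hΦ.injective hxy
      subst this
      exact hy
  rw [h]
  exact measure_congr (inter_ae_eq_left_of_ae_eq_univ (by
    rw [ae_eq_univ]
    exact hr))

/-- Invariant measures for a system embedded in a compact one: if the orbit of `x` visits `K`,
whose image is compact, with positive upper Banach density, then there is an invariant probability
measure charging `K` and carried by the forward orbit of `K`. -/
theorem exists_invariant_measure_of_semiconj {X Q : Type*} [TopologicalSpace X] [PolishSpace X]
    [MeasurableSpace X] [BorelSpace X] [TopologicalSpace Q] [CompactSpace Q]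
    [TopologicalSpace.MetrizableSpace Q] [MeasurableSpace Q] [BorelSpace Q]
    {T : X → X} (hT : Continuous T) {τ : Q → Q} (hτ : Continuous τ) {Φ : X → Q}
    (hΦ : Continuous Φ) (hinj : Function.Injective Φ) (hsemi : ∀ x, Φ (T x) = τ (Φ x))
    {x : X} {K : Set X} (hK : IsCompact (Φ '' K))
    (hd : 0 < upperBanachDensity (returnSet T x K)) :
    ∃ μ : Measure X, IsProbabilityMeasure μ ∧ MeasurePreserving T μ μ ∧ 0 < μ K ∧
      μ (⋃ n : ℕ, T^[n] '' K)ᶜ = 0 := by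
  have hsemi' : ∀ n y, Φ (T^[n] y) = τ^[n] (Φ y) := fun n y =>
    Function.Semiconj.iterate_right (f := Φ) hsemi n y
  -- Lusin–Souslin; this is where Polishness of `X` is needed.
  have hemb : MeasurableEmbedding Φ := hΦ.measurableEmbedding hinj
  have hret : returnSet τ (Φ x) (Φ '' K) = returnSet T x K := by
    ext n
    simp only [returnSet, ← hsemi', hinj.mem_set_image]
  obtain ⟨ν, hν, hνT, hνK⟩ := exists_invariant_measure_of_upperBanachDensity_pos hτ (Φ x)
    hK.isClosed (by rwa [hret])
  let E : Set Q := ⋃ n : ℕ, τ^[n] '' (Φ '' K)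
  have hEmeas : MeasurableSet E := MeasurableSet.iUnion fun n =>
    (hK.image (hτ.iterate n)).isClosed.measurableSet
  have hKE : Φ '' K ⊆ E := by
    refine Set.subset_iUnion_of_subset 0 ?_
    simp
  have hEτ : E ⊆ τ ⁻¹' E := by
    intro q hq
    obtain ⟨n, y, hy, rfl⟩ := Set.mem_iUnion.1 hq
    exact Set.mem_iUnion.2 ⟨n + 1, y, hy, Function.iterate_succ_apply' τ n y⟩
  have hEimg : E = Φ '' ⋃ n : ℕ, T^[n] '' K := by
    simp only [E, Set.image_iUnion, Set.image_image, hsemi']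
  obtain ⟨ρ, hρ, hρT, hρE, hρpos⟩ := exists_invariant_measure_of_subset_preimage hνT hEmeas hEτ
    (hνK.trans_le (measure_mono hKE)).ne'
  have hr : ρ (Set.range Φ)ᶜ = 0 := by
    refine measure_mono_null (Set.compl_subset_compl.2 ?_) hρE
    rw [hEimg]
    exact Set.image_subset_range _ _
  refine ⟨ρ.comap Φ, ⟨?_⟩, measurePreserving_comap hemb hT.measurable hsemi hρT hr, ?_, ?_⟩
  · rw [hemb.comap_apply, Set.image_univ]
    exact (prob_compl_eq_zero_iff hemb.measurableSet_range).1 hr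
  · rw [hemb.comap_apply]
    exact hρpos _ hKE hνK
  · rw [hemb.comap_apply]
    refine measure_mono_null ?_ hρE
    rw [hEimg]
    exact Set.image_compl_subset hinj

/-! ### Tools for a compact metrizable model. -/

/-- A separating family of continuous functions on a second countable space contains a countable
separating subfamily. -/
theorem exists_countable_separating {X ι Z : Type*} [TopologicalSpace X]
    [SecondCountableTopology X] [TopologicalSpace Z] [T2Space Z] {g : ι → X → Z}
    (hg : ∀ i, Continuous (g i)) (hsep : ∀ x y, (∀ i, g i x = g i y) → x = y) :
    ∃ D : Set ι, D.Countable ∧ ∀ x y, (∀ i ∈ D, g i x = g i y) → x = y := by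
  -- Lindelöf in `X × X`: countably many of the open sets of separated pairs cover their whole
  -- union.
  obtain ⟨D, hD, hU⟩ := TopologicalSpace.isOpen_iUnion_countable
    (fun i => {p : X × X | g i p.1 ≠ g i p.2}) fun i =>
      isOpen_ne_fun ((hg i).comp continuous_fst) ((hg i).comp continuous_snd)
  refine ⟨D, hD, fun x y h => hsep x y fun i => ?_⟩
  by_contra hne
  have : (x, y) ∈ ⋃ i, {p : X × X | g i p.1 ≠ g i p.2} := Set.mem_iUnion.2 ⟨i, hne⟩
  rw [← hU] at this
  obtain ⟨j, hj, hxy⟩ := Set.mem_iUnion₂.1 this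
  exact hxy (h j hj)

theorem exists_continuous_injective_closedBall (E : Type*) [NormedAddCommGroup E]
    [NormedSpace ℝ E] :
    ∃ b : E → Metric.closedBall (0 : E) 1, Continuous b ∧ Function.Injective b :=
  ⟨fun z => ⟨Homeomorph.unitBall z, Metric.ball_subset_closedBall (Homeomorph.unitBall z).2⟩,
    (continuous_subtype_val.comp Homeomorph.unitBall.continuous).subtype_mk _,
    fun _ _ h => Homeomorph.unitBall.injective
      (Subtype.ext (congrArg (fun w : Metric.closedBall (0 : E) 1 => (w : E)) h))⟩

variable {𝕜 : Type*} [RCLike 𝕜]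

/-! ### Weak-* compactness and weak-* closed neighbourhoods. -/

section Dual

variable {Y : Type*} [AddCommGroup Y] [Module 𝕜 Y] [TopologicalSpace Y]

/-- Alaoglu for an equicontinuous, pointwise bounded set of functionals. -/
theorem isCompact_closure_image_coe {B : Set (StrongDual 𝕜 Y)}
    (heq : Equicontinuous (fun (f : B) (y : Y) => (f : StrongDual 𝕜 Y) y))
    (hbd : ∀ y : Y, Bornology.IsBounded ((fun f : StrongDual 𝕜 Y => f y) '' B)) :
    IsCompact (closure ((fun (f : StrongDual 𝕜 Y) (y : Y) => f y) '' B)) ∧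
      closure ((fun (f : StrongDual 𝕜 Y) (y : Y) => f y) '' B) ⊆
        Set.range (fun (f : StrongDual 𝕜 Y) (y : Y) => f y) := by
  set A := (fun (f : StrongDual 𝕜 Y) (y : Y) => f y) '' B with hA
  constructor
  · have hc : IsCompact (Set.univ.pi fun y : Y => closure ((fun f : StrongDual 𝕜 Y => f y) '' B)) :=
      isCompact_univ_pi fun y => (hbd y).isCompact_closure
    refine hc.of_isClosed_subset isClosed_closure (closure_minimal ?_ hc.isClosed)
    rintro _ ⟨f, hf, rfl⟩ y -
    exact subset_closure ⟨f, hf, rfl⟩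
  · intro g hg
    have hadd : ∀ y z, g (y + z) = g y + g z := by
      intro y z
      have hcl : IsClosed {h : Y → 𝕜 | h (y + z) = h y + h z} :=
        isClosed_eq (continuous_apply _) ((continuous_apply y).add (continuous_apply z))
      exact closure_minimal (by rintro _ ⟨f, -, rfl⟩; exact map_add f y z) hcl hg
    have hsmul : ∀ (c : 𝕜) y, g (c • y) = c • g y := by
      intro c y
      have hcl : IsClosed {h : Y → 𝕜 | h (c • y) = c • h y} :=
        isClosed_eq (continuous_apply _) ((continuous_apply _).const_smul c)
      exact closure_minimal (by rintro _ ⟨f, -, rfl⟩; exact map_smul f c y) hcl hg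
    -- Equicontinuity survives pointwise closure, which makes the limit functional continuous.
    have hA' : Equicontinuous ((id : (Y → 𝕜) → Y → 𝕜) ∘ ((↑) : A → Y → 𝕜)) := by
      intro y V hV
      filter_upwards [heq y V hV] with z hz
      rintro ⟨_, f, hf, rfl⟩
      exact hz ⟨f, hf⟩
    have hcont : Continuous g := (hA'.closure' continuous_id).continuous ⟨g, hg⟩
    exact ⟨⟨⟨⟨g, hadd⟩, hsmul⟩, hcont⟩, rfl⟩

/-- The strong dual topology has a base of weak-* closed neighbourhoods. -/
theorem exists_isClosed_preimage_coe_subset {f : StrongDual 𝕜 Y} {W : Set (StrongDual 𝕜 Y)}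
    (hW : W ∈ 𝓝 f) :
    ∃ F : Set (Y → 𝕜), IsClosed F ∧ (fun (g : StrongDual 𝕜 Y) (y : Y) => g y) ⁻¹' F ∈ 𝓝 f ∧
      (fun (g : StrongDual 𝕜 Y) (y : Y) => g y) ⁻¹' F ⊆ W := by
  have hbasis := ContinuousLinearMap.hasBasis_nhds_zero_of_basis (σ := RingHom.id 𝕜) (E := Y)
    (Metric.nhds_basis_closedBall (x := (0 : 𝕜)))
  have hW' : (fun g => f + g) ⁻¹' W ∈ 𝓝 (0 : StrongDual 𝕜 Y) :=
    (continuous_const_add f).continuousAt.preimage_mem_nhds (by simpa using hW)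
  obtain ⟨⟨S, r⟩, ⟨hS, hr⟩, hsub⟩ := hbasis.mem_iff.1 hW'
  have hmem := hbasis.mem_of_mem (i := (S, r)) ⟨hS, hr⟩
  refine ⟨{h | ∀ y ∈ S, h y - f y ∈ Metric.closedBall (0 : 𝕜) r}, ?_, ?_, ?_⟩
  · simp only [Set.ofPred_forall]
    exact isClosed_biInter fun y _ =>
      Metric.isClosed_closedBall.preimage ((continuous_apply y).sub continuous_const)
  · have h1 : (fun g => g - f) ⁻¹' {g : StrongDual 𝕜 Y | ∀ y ∈ S, g y ∈ Metric.closedBall 0 r} ∈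
        𝓝 f := (continuous_sub_right f).continuousAt.preimage_mem_nhds (by simpa using hmem)
    exact h1
  · intro g hg
    have h1 : g - f ∈ {g : StrongDual 𝕜 Y | ∀ y ∈ S, g y ∈ Metric.closedBall 0 r} := hg
    simpa using hsub h1

end Dual

/-! ### Invariant measures for adjoint operators. -/

section Operator

variable {Y : Type*} [AddCommGroup Y] [Module 𝕜 Y] [TopologicalSpace Y]
  {X : Type*} [TopologicalSpace X] [PolishSpace X] [MeasurableSpace X] [BorelSpace X]

theorem exists_invariant_measure_of_isCompact [ContinuousSMul 𝕜 Y] {e : X → StrongDual 𝕜 Y} (he : Continuous e)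
    (hinj : Function.Injective e) {T : X → X} (hT : Continuous T) {S : Y → Y}
    (hS : ∀ x u, e (T x) u = e x (S u)) {x : X} {K : Set X}
    (hK : IsCompact ((fun x y => e x y) '' K))
    (hd : 0 < upperBanachDensity (returnSet T x K)) :
    ∃ μ : Measure X, IsProbabilityMeasure μ ∧ MeasurePreserving T μ μ ∧ 0 < μ K ∧
      μ (⋃ n : ℕ, T^[n] '' K)ᶜ = 0 := by
  have hev : ∀ y : Y, Continuous fun x => e x y := fun y => (continuous_eval_const y).comp he
  obtain ⟨D, hD, hsep⟩ := exists_countable_separating hev fun x y h =>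
    hinj (ContinuousLinearMap.ext h)
  obtain ⟨b, hb, hbinj⟩ := exists_continuous_injective_closedBall 𝕜
  have : Countable D := hD.to_subtype
  have hSn : ∀ n x u, e (T^[n] x) u = e x (S^[n] u) := by
    intro n
    induction n with
    | zero => intro x u; rfl
    | succ n ih =>
      intro x u
      rw [Function.iterate_succ_apply, ih, hS, Function.iterate_succ_apply' S]
  -- Recording all iterates `S^[n] d` lets the shift in `n` represent `T`, although `D` need not be
  -- `S`-invariant.
  let G : (Y → 𝕜) → ℕ → D → Metric.closedBall (0 : 𝕜) 1 := fun f n d => b (f (S^[n] d))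
  have hG : Continuous G := continuous_pi fun n => continuous_pi fun d =>
    hb.comp (continuous_apply _)
  have hτ : Continuous fun (q : ℕ → D → Metric.closedBall (0 : 𝕜) 1) n => q (n + 1) :=
    continuous_pi fun n => continuous_apply _
  refine exists_invariant_measure_of_semiconj hT hτ (Φ := fun x => G fun y => e x y)
    (hG.comp (continuous_pi hev)) ?_ ?_ ?_ hd
  · intro x y hxy
    refine hsep x y fun d hd => hbinj ?_
    exact congrFun (congrFun hxy 0) ⟨d, hd⟩
  · intro x
    funext n d
    exact congrArg b ((hS x _).trans (by rw [← Function.iterate_succ_apply' S]))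
  · have := hK.image hG
    rwa [Set.image_image] at this

/-- An operator on a dual space that is an adjoint admits, for each reiteratively recurrent point
whose orbit is locally equicontinuous, an invariant probability measure with that point in its
support and carried by the weak-* closure of the orbit. -/
theorem exists_invariant_measure_mem_support [ContinuousSMul 𝕜 Y] {e : X → StrongDual 𝕜 Y} (he : IsHomeomorph e)
    {T : X → X} (hT : Continuous T) {S : Y → Y} (hS : ∀ x u, e (T x) u = e x (S u)) {x : X}
    (hx : IsReiterativelyRecurrent T x) {U : Set X} (hU : U ∈ 𝓝 x)
    (heq : Equicontinuous fun (f : e '' (U ∩ orbit T x)) (y : Y) => (f : StrongDual 𝕜 Y) y)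
    (hbd : ∀ y : Y, Bornology.IsBounded ((fun z => e z y) '' (U ∩ orbit T x))) :
    ∃ μ : Measure X, IsProbabilityMeasure μ ∧ MeasurePreserving T μ μ ∧ x ∈ μ.support ∧
      μ.support ⊆ (fun z y => e z y) ⁻¹' closure ((fun z y => e z y) '' orbit T x) := by
  let c : X → Y → 𝕜 := fun z y => e z y
  have hc : Continuous c :=
    continuous_pi fun y => (continuous_eval_const y).comp he.continuous
  set O : Set X := c ⁻¹' closure (c '' orbit T x) with hO
  have hOT : Set.MapsTo T O O := by
    intro z hz
    -- Precomposition with `S` is pointwise continuous whether or not `S` is.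
    have h1 : Continuous fun (g : Y → 𝕜) y => g (S y) :=
      continuous_pi fun y => continuous_apply _
    have h2 : Set.MapsTo (fun (g : Y → 𝕜) y => g (S y)) (c '' orbit T x) (c '' orbit T x) := by
      rintro _ ⟨w, ⟨n, hn, rfl⟩, rfl⟩
      refine ⟨T (T^[n] x), ⟨n + 1, by omega, Function.iterate_succ_apply' T n x⟩, ?_⟩
      funext y
      exact hS _ y
    have h3 := h2.closure h1 hz
    have h4 : c (T z) = fun y => c z (S y) := funext fun y => hS z y
    change c (T z) ∈ closure (c '' orbit T x)
    rw [h4]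
    exact h3
  have key : ∀ V ∈ 𝓝 x, ∃ μ : Measure X, IsProbabilityMeasure μ ∧ MeasurePreserving T μ μ ∧
      0 < μ V ∧ μ Oᶜ = 0 := by
    intro V hV
    obtain ⟨F, hF, hFx, hFV⟩ := exists_isClosed_preimage_coe_subset
      (he.isOpenMap.image_mem_nhds (inter_mem hU hV))
    have hcF : c ⁻¹' F ∈ 𝓝 x := he.continuous.continuousAt.preimage_mem_nhds hFx
    have hFsub : c ⁻¹' F ⊆ U ∩ V := by
      intro z hz
      exact (he.injective.mem_set_image).1 (hFV (show e z ∈ _ from hz))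
    let B : Set X := c ⁻¹' F ∩ orbit T x
    have hBU : B ⊆ U ∩ orbit T x := fun z hz => ⟨(hFsub hz.1).1, hz.2⟩
    have hcB : (fun (f : StrongDual 𝕜 Y) (y : Y) => f y) '' (e '' B) = c '' B := by
      rw [Set.image_image]
    obtain ⟨hcomp, hrange⟩ := isCompact_closure_image_coe (B := e '' B)
      (by
        intro y W hW
        filter_upwards [heq y W hW] with z hz f
        exact hz ⟨f, Set.image_mono hBU f.2⟩)
      (fun y => (hbd y).subset (by
        rw [Set.image_image]
        exact Set.image_mono hBU))
    rw [hcB] at hcomp hrange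
    let K : Set X := c ⁻¹' closure (c '' B)
    have hKimg : c '' K = closure (c '' B) := by
      refine Set.image_preimage_eq_of_subset (hrange.trans ?_)
      rintro _ ⟨f, rfl⟩
      obtain ⟨z, rfl⟩ := he.surjective f
      exact ⟨z, rfl⟩
    -- Weak-* closedness of `F` keeps the closure of `B` inside `V`.
    have hKV : K ⊆ V := fun z hz => (hFsub (closure_minimal
      (Set.image_subset_iff.2 Set.inter_subset_left) hF hz)).2
    have hKO : K ⊆ O := Set.preimage_mono (closure_mono (Set.image_mono Set.inter_subset_right))
    have hret : returnSet T x (c ⁻¹' F) ⊆ returnSet T x K := fun n hn =>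
      ⟨hn.1, subset_closure ⟨_, ⟨hn.2, n, hn.1, rfl⟩, rfl⟩⟩
    obtain ⟨μ, hμ, hμT, hμK, hμO⟩ := exists_invariant_measure_of_isCompact he.continuous
      he.injective hT hS (x := x) (K := K) (by rw [hKimg]; exact hcomp)
      ((hx _ hcF).trans_le (upperBanachDensity_mono hret))
    refine ⟨μ, hμ, hμT, hμK.trans_le (measure_mono hKV), measure_mono_null ?_ hμO⟩
    refine Set.compl_subset_compl.2 (Set.iUnion_subset fun n => ?_)
    exact ((hOT.iterate n).mono_left hKO).image_subset
  obtain ⟨V, hV⟩ := (𝓝 x).exists_antitone_basis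
  choose μ hμ hμT hμV hμO using fun n => key (V n) (hV.1.mem_of_mem trivial)
  obtain ⟨ν, hν, hνT, hν0⟩ := exists_invariant_measure_apply_eq_zero_iff hμ hμT
  refine ⟨ν, hν, hνT, ?_, ?_⟩
  · rw [Measure.mem_support_iff_forall]
    intro W hW
    obtain ⟨n, -, hn⟩ := hV.1.mem_iff.1 hW
    refine pos_iff_ne_zero.2 fun h0 => ?_
    exact (hμV n).ne' (measure_mono_null hn ((hν0 W).1 h0 n))
  · exact Measure.support_subset_of_isClosed (isClosed_closure.preimage hc)
      ((hν0 _).2 hμO)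

end Operator

/-! ### Full support, and the two sources of equicontinuity. -/

theorem ne_dirac_of_mem_support {X : Type*} [TopologicalSpace X] [T1Space X] [MeasurableSpace X]
    [OpensMeasurableSpace X] {μ : Measure X} {x a : X} (hx : x ∈ μ.support) (hne : x ≠ a) :
    μ ≠ Measure.dirac a := by
  rintro rfl
  have h := (Measure.mem_support_iff_forall x).1 hx {a}ᶜ (isOpen_compl_singleton.mem_nhds hne)
  simp [Measure.dirac_apply' _ (isOpen_compl_singleton (x := a)).measurableSet] at h

/-- If a dense set of points lie in supports of invariant probability measures, then there is an
invariant probability measure with full support. -/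
theorem exists_invariant_measure_fullSupport {X : Type*} [TopologicalSpace X] [Nonempty X]
    [SecondCountableTopology X] [MeasurableSpace X] {T : X → X} {s : Set X} (hs : Dense s)
    (h : ∀ x ∈ s, ∃ μ : Measure X, IsProbabilityMeasure μ ∧ MeasurePreserving T μ μ ∧
      x ∈ μ.support) :
    ∃ μ : Measure X, IsProbabilityMeasure μ ∧ MeasurePreserving T μ μ ∧
      ∀ U : Set X, IsOpen U → U.Nonempty → 0 < μ U := by
  obtain ⟨t, hts, htc, htd⟩ := hs.exists_countable_dense_subset
  obtain ⟨a, ha⟩ := htc.exists_eq_range htd.nonempty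
  choose μ hμ hμT hμa using fun n => h (a n) (hts (ha ▸ Set.mem_range_self n))
  obtain ⟨ν, hν, hνT, hν0⟩ := exists_invariant_measure_apply_eq_zero_iff hμ hμT
  refine ⟨ν, hν, hνT, fun U hU hUn => pos_iff_ne_zero.2 fun h0 => ?_⟩
  obtain ⟨z, hzU, hzt⟩ := htd.inter_open_nonempty U hU hUn
  rw [ha] at hzt
  obtain ⟨n, rfl⟩ := hzt
  exact ((Measure.mem_support_iff_forall _).1 (hμa n) U (hU.mem_nhds hzU)).ne' ((hν0 U).1 h0 n)

theorem polishSpace_of_separable (X : Type*) [TopologicalSpace X]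
    [TopologicalSpace.SeparableSpace X] [TopologicalSpace.IsCompletelyMetrizableSpace X] :
    PolishSpace X := by
  let _ := TopologicalSpace.metrizableSpaceMetric X
  have := UniformSpace.secondCountable_of_separable X
  exact {}

theorem orbit_countable {X : Type*} (T : X → X) (x : X) : (orbit T x).Countable :=
  (Set.countable_range fun n => T^[n] x).mono (by rintro z ⟨n, -, hn⟩; exact ⟨n, hn⟩)

/-- The hypothesis concerns sequences only; countability lets `B` be enumerated as one. -/
theorem IsQuasiLInftyBarrelled.equicontinuous {Y : Type*} [AddCommGroup Y] [Module 𝕜 Y]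
    [TopologicalSpace Y] (hY : IsQuasiLInftyBarrelled 𝕜 Y) {B : Set (StrongDual 𝕜 Y)}
    (hB : B.Countable) (hbd : Bornology.IsVonNBounded 𝕜 B) :
    Equicontinuous fun (f : B) (y : Y) => (f : StrongDual 𝕜 Y) y := by
  rcases B.eq_empty_or_nonempty with rfl | hne
  · exact fun y V _ => Eventually.of_forall fun z f => f.2.elim
  · obtain ⟨f, rfl⟩ := hB.exists_eq_range hne
    intro y V hV
    filter_upwards [hY f hbd y V hV] with z hz
    rintro ⟨_, n, rfl⟩
    exact hz n

theorem isBounded_image_of_isVonNBounded {X : Type*} [AddCommGroup X] [Module 𝕜 X]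
    [TopologicalSpace X] {B : Set X} (hB : Bornology.IsVonNBounded 𝕜 B) (u : X →L[𝕜] 𝕜) :
    Bornology.IsBounded (u '' B) :=
  (NormedSpace.isVonNBounded_iff 𝕜).1 (hB.image u)

/-- A bounded subset of `X` is equicontinuous on the strong dual of `X`. -/
theorem equicontinuous_evalBidual {X : Type*} [AddCommGroup X] [Module 𝕜 X]
    [TopologicalSpace X] [ContinuousSMul 𝕜 X] {B : Set X}
    (hB : Bornology.IsVonNBounded 𝕜 B) :
    Equicontinuous fun (f : evalBidual 𝕜 '' B) (u : StrongDual 𝕜 X) =>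
      (f : StrongDual 𝕜 (StrongDual 𝕜 X)) u := by
  refine equicontinuous_of_equicontinuousAt_zero
    (fun f : evalBidual 𝕜 '' B => (f : StrongDual 𝕜 (StrongDual 𝕜 X))) ?_
  rw [Metric.equicontinuousAt_iff_right]
  intro ε hε
  -- Functionals that are small on the bounded set `B` form a strong neighbourhood of zero.
  filter_upwards [ContinuousLinearMap.eventually_nhds_zero_mapsTo hB
    (Metric.ball_mem_nhds (0 : 𝕜) hε)] with u hu
  rintro ⟨_, x, hx, rfl⟩
  have h := hu hx
  change dist (evalBidual 𝕜 x 0) (evalBidual 𝕜 x u) < ε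
  rw [map_zero, dist_comm]
  exact h

theorem weakStarClosure_eq {Y : Type*} [AddCommGroup Y] [Module 𝕜 Y] [TopologicalSpace Y]
    (A : Set (StrongDual 𝕜 Y)) :
    weakStarClosure A = (fun (f : StrongDual 𝕜 Y) (y : Y) => f y) ⁻¹'
      closure ((fun (f : StrongDual 𝕜 Y) (y : Y) => f y) '' A) := by
  have h : IsInducing fun (f : WeakDual 𝕜 Y) (y : Y) => f y := ⟨rfl⟩
  rw [weakStarClosure, h.closure_eq_preimage_closure_image, Set.image_image]
  rfl

theorem weakClosure_eq {X : Type*} [AddCommGroup X] [Module 𝕜 X] [TopologicalSpace X]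
    [ContinuousSMul 𝕜 X] (A : Set X) :
    weakClosure 𝕜 A = (fun (x : X) (u : StrongDual 𝕜 X) => evalBidual 𝕜 x u) ⁻¹'
      closure ((fun (x : X) (u : StrongDual 𝕜 X) => evalBidual 𝕜 x u) '' A) := by
  have h : IsInducing fun (x : WeakSpace 𝕜 X) (u : StrongDual 𝕜 X) =>
      u ((toWeakSpace 𝕜 X).symm x) := ⟨rfl⟩
  rw [weakClosure, h.closure_eq_preimage_closure_image, Set.image_image]
  rfl

end LinDyn

/-! ### The theorem. -/

theorem theorem2p3 {𝕜 : Type*} [RCLike 𝕜] :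
    (∀ (Y : Type*) [AddCommGroup Y] [Module 𝕜 Y] [Module ℝ Y] [IsScalarTower ℝ 𝕜 Y]
        [TopologicalSpace Y] [IsTopologicalAddGroup Y] [ContinuousSMul 𝕜 Y]
        [LocallyConvexSpace ℝ Y] [T2Space Y]
        [MeasurableSpace (StrongDual 𝕜 Y)] [BorelSpace (StrongDual 𝕜 Y)]
        [TopologicalSpace.SeparableSpace (StrongDual 𝕜 Y)]
        [TopologicalSpace.IsCompletelyMetrizableSpace (StrongDual 𝕜 Y)],
      LinDyn.IsQuasiLInftyBarrelled 𝕜 Y →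
      ∀ (T : StrongDual 𝕜 Y →L[𝕜] StrongDual 𝕜 Y) (S : Y →ₗ[𝕜] Y),
        (∀ (u : Y) (x : StrongDual 𝕜 Y), x (S u) = (T x) u) →
        (∀ x₀ : StrongDual 𝕜 Y,
          LinDyn.IsReiterativelyRecurrent T x₀ → LinDyn.HasLocallyBoundedOrbit 𝕜 T x₀ →
          ∃ μ : Measure (StrongDual 𝕜 Y), IsProbabilityMeasure μ ∧ MeasurePreserving T μ μ ∧
            (x₀ ≠ 0 → μ ≠ Measure.dirac 0) ∧
            x₀ ∈ μ.support ∧ μ.support ⊆ LinDyn.weakStarClosure (LinDyn.orbit T x₀)) ∧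
        (Dense {x : StrongDual 𝕜 Y | LinDyn.IsReiterativelyRecurrent T x ∧
            LinDyn.HasLocallyBoundedOrbit 𝕜 T x} →
          ∃ μ : Measure (StrongDual 𝕜 Y), IsProbabilityMeasure μ ∧ MeasurePreserving T μ μ ∧
            ∀ U : Set (StrongDual 𝕜 Y), IsOpen U → U.Nonempty → 0 < μ U)) ∧
    (∀ (X : Type*) [AddCommGroup X] [Module 𝕜 X] [Module ℝ X] [IsScalarTower ℝ 𝕜 X]
        [TopologicalSpace X] [IsTopologicalAddGroup X] [ContinuousSMul 𝕜 X]
        [LocallyConvexSpace ℝ X] [MeasurableSpace X] [BorelSpace X]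
        [TopologicalSpace.SeparableSpace X] [TopologicalSpace.IsCompletelyMetrizableSpace X],
      LinDyn.IsReflexiveSpace 𝕜 X →
      ∀ T : X →L[𝕜] X,
        (∀ x₀ : X,
          LinDyn.IsReiterativelyRecurrent T x₀ → LinDyn.HasLocallyBoundedOrbit 𝕜 T x₀ →
          ∃ μ : Measure X, IsProbabilityMeasure μ ∧ MeasurePreserving T μ μ ∧
            (x₀ ≠ 0 → μ ≠ Measure.dirac 0) ∧
            x₀ ∈ μ.support ∧ μ.support ⊆ LinDyn.weakClosure 𝕜 (LinDyn.orbit T x₀)) ∧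
        (Dense {x : X | LinDyn.IsReiterativelyRecurrent T x ∧
            LinDyn.HasLocallyBoundedOrbit 𝕜 T x} →
          ∃ μ : Measure X, IsProbabilityMeasure μ ∧ MeasurePreserving T μ μ ∧
            ∀ U : Set X, IsOpen U → U.Nonempty → 0 < μ U)) := by
  constructor
  · intro Y _ _ _ _ _ _ _ _ _ _ _ _ _ hY T S hS
    have := LinDyn.polishSpace_of_separable (StrongDual 𝕜 Y)
    have key : ∀ x₀ : StrongDual 𝕜 Y,
        LinDyn.IsReiterativelyRecurrent T x₀ → LinDyn.HasLocallyBoundedOrbit 𝕜 T x₀ →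
        ∃ μ : Measure (StrongDual 𝕜 Y), IsProbabilityMeasure μ ∧ MeasurePreserving T μ μ ∧
          x₀ ∈ μ.support ∧ μ.support ⊆ LinDyn.weakStarClosure (LinDyn.orbit T x₀) := by
      rintro x₀ hx ⟨U, hU, hbd⟩
      rw [LinDyn.weakStarClosure_eq]
      refine LinDyn.exists_invariant_measure_mem_support (e := fun f : StrongDual 𝕜 Y => f)
        IsHomeomorph.id T.continuous (S := S) (fun x u => (hS u x).symm) hx hU ?_ fun y => ?_
      · rw [Set.image_id']
        exact hY.equicontinuous ((LinDyn.orbit_countable T x₀).mono Set.inter_subset_right) hbd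
      · exact LinDyn.isBounded_image_of_isVonNBounded hbd (LinDyn.evalBidual 𝕜 y)
    refine ⟨fun x₀ hx hb => ?_, fun hd => ?_⟩
    · obtain ⟨μ, h1, h2, h3, h4⟩ := key x₀ hx hb
      exact ⟨μ, h1, h2, LinDyn.ne_dirac_of_mem_support h3, h3, h4⟩
    · refine LinDyn.exists_invariant_measure_fullSupport hd fun x hx => ?_
      obtain ⟨μ, h1, h2, h3, -⟩ := key x hx.1 hx.2
      exact ⟨μ, h1, h2, h3⟩
  · intro X _ _ _ _ _ _ _ _ _ _ _ _ hX T
    have := LinDyn.polishSpace_of_separable X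
    have key : ∀ x₀ : X,
        LinDyn.IsReiterativelyRecurrent T x₀ → LinDyn.HasLocallyBoundedOrbit 𝕜 T x₀ →
        ∃ μ : Measure X, IsProbabilityMeasure μ ∧ MeasurePreserving T μ μ ∧
          x₀ ∈ μ.support ∧ μ.support ⊆ LinDyn.weakClosure 𝕜 (LinDyn.orbit T x₀) := by
      rintro x₀ hx ⟨U, hU, hbd⟩
      rw [LinDyn.weakClosure_eq]
      -- Reflexivity identifies `X` with the dual of its strong dual, where `T` is the adjoint of
      -- its own transpose.
      exact LinDyn.exists_invariant_measure_mem_support hX T.continuous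
        (S := fun u : StrongDual 𝕜 X => u.comp T) (fun x u => rfl) hx hU
        (LinDyn.equicontinuous_evalBidual hbd)
        fun u => LinDyn.isBounded_image_of_isVonNBounded hbd u
    refine ⟨fun x₀ hx hb => ?_, fun hd => ?_⟩
    · obtain ⟨μ, h1, h2, h3, h4⟩ := key x₀ hx hb
      exact ⟨μ, h1, h2, LinDyn.ne_dirac_of_mem_support h3, h3, h4⟩
    · refine LinDyn.exists_invariant_measure_fullSupport hd fun x hx => ?_
      obtain ⟨μ, h1, h2, h3, -⟩ := key x hx.1 hx.2
      exact ⟨μ, h1, h2, h3⟩
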